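/- **Lemma 3.1.** Let $k$ be a field, $A$ a finite-dimensional associative unital $k$-algebra and $K/k$ a finite separable field extension. Then $$\mathrm{s.gl.dim}\,A=\mathrm{s.gl.dim}\,(A\otimes_k K)\quad\text{in } \mathbb N\cup\{\infty\}.$$ Here, for a ring $R$, $\mathbf K^b(R\text{-proj})$ is the bounded homotopy category of finitely generated projective left $R$-modules, and the strong global dimension is $$\mathrm{s.gl.dim}\,R=\sup\{\,l(P)\mid 0\neq P\in\mathbf K^b(R\text{-proj})\text{ indecomposable}\,\}$$ (with $\sup\emptyset=0$). The length of a nonzero complex $Q=(Q^i,d^i)$ is $\max\{b-a\mid Q^b\neq0,\ Q^a\neq0\}$ (and $0$ for the zero complex), and the length $l(P)$ of an object $P$ of $\mathbf K^b(R\text{-proj})$ is the smallest length of a complex of finitely generated projective left $R$-modules that is isomorphic to $P$ in the homotopy category. -/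

import Mathlib

open CategoryTheory CategoryTheory.Limits
open scoped TensorProduct

noncomputable section

universe w

section Modules

variable (R : Type w) [Ring R]

/-- The property of being a finitely generated projective left `R`-module. -/
def isFGProjective : ObjectProperty (ModuleCat.{w} R) :=
  fun M => Module.Finite R M ∧ Module.Projective R M

/-- The category `R`-proj of finitely generated projective left `R`-modules. -/
abbrev FGProj := (isFGProjective R).FullSubcategory

instance : (isFGProjective R).IsClosedUnderIsomorphisms where
  of_iso {M N} e h := by
    obtain ⟨_, _⟩ := h
    exact ⟨Module.Finite.equiv e.toLinearEquiv, Module.Projective.of_equiv e.toLinearEquiv⟩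

instance : (isFGProjective R).ContainsZero where
  exists_zero := ⟨ModuleCat.of R PUnit, ModuleCat.isZero_of_subsingleton _,
    ⟨inferInstanceAs (Module.Finite R PUnit.{w + 1}),
      inferInstanceAs (Module.Projective R PUnit.{w + 1})⟩⟩

instance : (isFGProjective R).IsClosedUnderBinaryProducts := by
  refine ObjectProperty.IsClosedUnderLimitsOfShape.mk' ?_
  rintro _ ⟨F, hF⟩
  obtain ⟨_, _⟩ := hF ⟨WalkingPair.left⟩
  obtain ⟨_, _⟩ := hF ⟨WalkingPair.right⟩
  let e : limit F ≅ ModuleCat.of R (F.obj ⟨WalkingPair.left⟩ × F.obj ⟨WalkingPair.right⟩) :=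
    HasLimit.isoOfNatIso (diagramIsoPair F) ≪≫ (biprod.isoProd _ _).symm ≪≫
      ModuleCat.biprodIsoProd _ _
  refine (isFGProjective R).prop_of_iso e.symm ⟨?_, ?_⟩
  · exact inferInstanceAs
      (Module.Finite R (F.obj ⟨WalkingPair.left⟩ × F.obj ⟨WalkingPair.right⟩))
  · exact inferInstanceAs
      (Module.Projective R (F.obj ⟨WalkingPair.left⟩ × F.obj ⟨WalkingPair.right⟩))

instance : HasBinaryProducts (FGProj R) := hasLimitsOfShape_of_closedUnderLimits _ _

instance : HasBinaryBiproducts (FGProj R) := HasBinaryBiproducts.of_hasBinaryProducts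

end Modules

section HomotopyCategory

universe v u

variable (C : Type u) [Category.{v} C] [Preadditive C]

/-- The objects of the homotopy category `K(C)` whose underlying cochain complex is bounded,
i.e. has only finitely many nonzero terms. -/
def isBoundedComplex : ObjectProperty (HomotopyCategory C (.up ℤ)) :=
  fun X => ∃ a b : ℤ, CochainComplex.IsStrictlyGE X.as a ∧ CochainComplex.IsStrictlyLE X.as b

/-- The bounded homotopy category `K^b(C)`. -/
abbrev BoundedHomotopyCategory := (isBoundedComplex C).FullSubcategory

instance [HasBinaryBiproducts C] : HasBinaryBiproducts (BoundedHomotopyCategory C) := by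
  refine ⟨fun X Y => ?_⟩
  obtain ⟨a₁, b₁, _, _⟩ := X.property
  obtain ⟨a₂, b₂, _, _⟩ := Y.property
  let K : CochainComplex C ℤ := X.obj.as
  let L : CochainComplex C ℤ := Y.obj.as
  have hXY (n : ℤ) (hK : IsZero (K.X n)) (hL : IsZero (L.X n)) : IsZero ((K ⊞ L).X n) := by
    refine IsZero.of_iso ?_ (HomologicalComplex.biprodXIso K L n)
    rw [IsZero.iff_id_eq_zero]
    ext
    · exact hK.eq_of_src _ _
    · exact hK.eq_of_src _ _
    · exact hL.eq_of_src _ _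
    · exact hL.eq_of_src _ _
  let q := HomotopyCategory.quotient C (.up ℤ)
  let P : BoundedHomotopyCategory C := ⟨q.obj (K ⊞ L), min a₁ a₂, max b₁ b₂, by
      rw [CochainComplex.isStrictlyGE_iff]
      intro i hi
      exact hXY i (CochainComplex.isZero_of_isStrictlyGE K a₁ i (by grind))
        (CochainComplex.isZero_of_isStrictlyGE L a₂ i (by grind)), by
      rw [CochainComplex.isStrictlyLE_iff]
      intro i hi
      exact hXY i (CochainComplex.isZero_of_isStrictlyLE K b₁ i (by grind))
        (CochainComplex.isZero_of_isStrictlyLE L b₂ i (by grind))⟩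
  let b : BinaryBicone X Y :=
    { pt := P
      fst := ObjectProperty.homMk (q.map (biprod.fst : K ⊞ L ⟶ K))
      snd := ObjectProperty.homMk (q.map (biprod.snd : K ⊞ L ⟶ L))
      inl := ObjectProperty.homMk (q.map (biprod.inl : K ⟶ K ⊞ L))
      inr := ObjectProperty.homMk (q.map (biprod.inr : L ⟶ K ⊞ L))
      inl_fst := by
        ext; exact (q.map_comp _ _).symm.trans (by rw [biprod.inl_fst]; exact q.map_id K)
      inl_snd := by
        ext; exact (q.map_comp _ _).symm.trans (by rw [biprod.inl_snd]; exact q.map_zero K L)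
      inr_fst := by
        ext; exact (q.map_comp _ _).symm.trans (by rw [biprod.inr_fst]; exact q.map_zero L K)
      inr_snd := by
        ext; exact (q.map_comp _ _).symm.trans (by rw [biprod.inr_snd]; exact q.map_id L) }
  refine hasBinaryBiproduct_of_total b ?_
  ext
  change q.map _ ≫ q.map _ + q.map _ ≫ q.map _ = 𝟙 (q.obj (K ⊞ L))
  rw [← q.map_comp, ← q.map_comp, ← q.map_add, biprod.total, q.map_id]

variable {C}

/-- The length `max {b - a | P^b ≠ 0, P^a ≠ 0}` of a cochain complex `P`. -/
def complexLength (P : CochainComplex C ℤ) : ℕ∞ :=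
  ⨆ (a : ℤ) (b : ℤ) (_ : ¬ IsZero (P.X a)) (_ : ¬ IsZero (P.X b)), ((b - a).toNat : ℕ∞)

/-- The length of an object `X` of `K^b(C)`. The length of a complex is not invariant under
homotopy equivalence (one can add contractible summands), so one takes the smallest length of a
complex isomorphic to `X` in the homotopy category. (When minimal complexes exist, e.g. for
finitely generated projective modules over a finite-dimensional algebra, this is the length of the
minimal complex representing `X`.) -/
def BoundedHomotopyCategory.length (X : BoundedHomotopyCategory C) : ℕ∞ :=
  ⨅ (Q : CochainComplex C ℤ)
    (_ : Nonempty ((HomotopyCategory.quotient C (.up ℤ)).obj Q ≅ X.obj)), complexLength Q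

end HomotopyCategory

/-- The strong global dimension of a ring `R`: the supremum in `ℕ ∪ {∞}` of the lengths of the
(nonzero) indecomposable objects of `K^b(R-proj)`. -/
def strongGlobalDimension (R : Type w) [Ring R] : ℕ∞ :=
  ⨆ (P : BoundedHomotopyCategory (FGProj R)) (_ : Indecomposable P), P.length

end

/-! Let `F = - ⊗ K` be induction from `A`-proj to `A ⊗ K`-proj and `G` restriction along `A → A ⊗
K`. Each composite has the identity functor as a natural retract. For `G F`, the unit `m ↦ m ⊗ 1` is
split by `m ⊗ x ↦ c x • m`, where `c : K → k` is a linear form with `c 1 = 1`. For `F G`, the counit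
`m ⊗ x ↦ x m` is split by the separability idempotent of `K ⊗ K`; this is where separability enters.
Both retractions pass to `K^b`.

The rest is symmetric in the two functors (`iSup_length_le_iSup_length`). An indecomposable `P` is a
retract of `G (F P)`, but `F P` may decompose. Since `End P` is local (Fitting's lemma), `P` is
already a retract of `G Q` for some indecomposable summand `Q` of `F P`
(`exists_indecomposable_retract`). Then `l(P) ≤ l(G Q) ≤ l(Q)`: an additive functor preserves zero
terms, which gives the second inequality.

The first inequality says that length does not grow under retracts in the homotopy category
(`BoundedHomotopyCategory.length_le_of_retract`). Minimal complexes are avoided: if `K` is a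
homotopy retract of a complex concentrated in `[a, b]`, the homotopy contracts `K` outside `[a, b]`,
and truncating it yields idempotents that split off the superfluous part. -/

noncomputable section

/-! ### Homotopy retracts and the length of a complex -/

section Truncation

universe v u

variable {C : Type u} [Category.{v} C] [Preadditive C]

theorem CategoryTheory.Limits.IsZero.of_retract {D : Type*} [Category D] [HasZeroMorphisms D]
    {X Y : D} (h : IsZero Y) (r : Retract X Y) : IsZero X := by
  rw [IsZero.iff_id_eq_zero, ← r.retract, h.eq_of_tgt r.i 0, zero_comp]

/-- A retract of cochain complexes gives a retract in every degree. -/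
def cochainRetractEval {K L : CochainComplex C ℤ} (r : Retract K L) (n : ℤ) :
    Retract (K.X n) (L.X n) :=
  r.map (HomologicalComplex.eval C (.up ℤ) n)

/-- With `N` the null-homotopic map of `T`, `1 - N` is an idempotent chain map homotopic to the
identity. Its image `M` therefore represents the same homotopy type as `K`, and it vanishes wherever
`N` is the identity. -/
theorem exists_retract_of_idempotent_id_sub_nullHomotopicMap [IsIdempotentComplete C]
    {K : CochainComplex C ℤ} (T : ∀ i j, K.X i ⟶ K.X j)
    (hT : ∀ i j, ¬ (ComplexShape.up ℤ).Rel j i → T i j = 0)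
    (hN : ∀ n, (Homotopy.nullHomotopicMap T).f n ≫ (Homotopy.nullHomotopicMap T).f n =
      (Homotopy.nullHomotopicMap T).f n) :
    ∃ (M : CochainComplex C ℤ) (_ : Retract M K),
      Nonempty ((HomotopyCategory.quotient C (.up ℤ)).obj M ≅
        (HomotopyCategory.quotient C (.up ℤ)).obj K) ∧
      ∀ n, (Homotopy.nullHomotopicMap T).f n = 𝟙 _ → IsZero (M.X n) := by
  set N := Homotopy.nullHomotopicMap T with hNdef
  have hN' : N ≫ N = N := by ext n; exact hN n
  have he : (𝟙 K - N) ≫ (𝟙 K - N) = 𝟙 K - N := by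
    simp [hN']
  obtain ⟨M, i, p, hip, hpi⟩ := IsIdempotentComplete.idempotents_split K _ he
  refine ⟨M, ⟨i, p, hip⟩, ⟨⟨(HomotopyCategory.quotient C _).map i,
    (HomotopyCategory.quotient C _).map p, ?_, ?_⟩⟩, fun n hn => ?_⟩
  · rw [← Functor.map_comp, hip, CategoryTheory.Functor.map_id]
  · rw [← Functor.map_comp, hpi, Functor.map_sub, CategoryTheory.Functor.map_id,
      HomotopyCategory.eq_of_homotopy _ _ (Homotopy.nullHomotopy T hT), Functor.map_zero, sub_zero]
  · have h0 : p.f n ≫ i.f n = 0 := by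
      rw [← HomologicalComplex.comp_f, hpi]
      simp [hn]
    have h1 : i.f n ≫ p.f n = 𝟙 _ := by
      rw [← HomologicalComplex.comp_f, hip]; rfl
    rw [IsZero.iff_id_eq_zero, ← Category.id_comp (𝟙 _), ← h1, Category.assoc,
      reassoc_of% h0, zero_comp, comp_zero]

theorem nullHomotopicMap_up_f {K : CochainComplex C ℤ} (T : ∀ i j, K.X i ⟶ K.X j) (n : ℤ) :
    (Homotopy.nullHomotopicMap T).f n =
      K.d n (n + 1) ≫ T (n + 1) n + T n (n - 1) ≫ K.d (n - 1) n :=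
  Homotopy.nullHomotopicMap_f (c := .up ℤ) (by simp) (by simp) T

theorem homotopy_up_comm {K L : CochainComplex C ℤ} {f : K ⟶ L} {g : L ⟶ K}
    (H : Homotopy (𝟙 K) (f ≫ g)) {n : ℤ} (hn : IsZero (L.X n)) :
    K.d n (n + 1) ≫ H.hom (n + 1) n + H.hom n (n - 1) ≫ K.d (n - 1) n = 𝟙 _ := by
  have h := H.comm n
  rw [dNext_eq (i := n) (i' := n + 1) H.hom (by simp),
    prevD_eq (j := n) (j' := n - 1) H.hom (by simp), HomologicalComplex.comp_f,
    hn.eq_of_tgt (f.f n) 0, zero_comp, add_zero] at h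
  exact h.symm

/-- Keep only the components of the homotopy that start in degrees `≤ a`; degree `a` is included
because contracting degree `a - 1` uses `H.hom a (a - 1)`. The resulting null-homotopic map is `1`
below `a` and `0` above. In degree `a` it is `H` followed by `d`, which is idempotent because `H`
contracts degree `a - 1` and `d ≫ d = 0`. -/
theorem exists_iso_isZero_lt [IsIdempotentComplete C] {K L : CochainComplex C ℤ}
    {f : K ⟶ L} {g : L ⟶ K} (H : Homotopy (𝟙 K) (f ≫ g)) (a : ℤ)
    (hL : ∀ n < a, IsZero (L.X n)) :
    ∃ (M : CochainComplex C ℤ) (_ : Retract M K),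
      Nonempty ((HomotopyCategory.quotient C (.up ℤ)).obj M ≅
        (HomotopyCategory.quotient C (.up ℤ)).obj K) ∧ ∀ n < a, IsZero (M.X n) := by
  let T : ∀ i j, K.X i ⟶ K.X j := fun i j => if i ≤ a then H.hom i j else 0
  have hlt : ∀ n < a, (Homotopy.nullHomotopicMap T).f n = 𝟙 _ := fun n hn => by
    rw [nullHomotopicMap_up_f, ← homotopy_up_comm H (hL n hn)]
    simp only [T, if_pos (show n + 1 ≤ a by lia), if_pos hn.le]
  obtain ⟨M, r, e, hM⟩ := exists_retract_of_idempotent_id_sub_nullHomotopicMap T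
    (fun i j hij => by simp only [T, H.zero i j hij, ite_self]) (fun n => by
      rcases lt_trichotomy n a with hn | rfl | hn
      · rw [hlt n hn, Category.comp_id]
      · have h := homotopy_up_comm H (hL (n - 1) (by lia))
        rw [sub_add_cancel] at h
        have h' : K.d (n - 1) n ≫ H.hom n (n - 1) =
            𝟙 _ - H.hom (n - 1) (n - 1 - 1) ≫ K.d (n - 1 - 1) (n - 1) := by
          rw [← h]; abel
        rw [nullHomotopicMap_up_f]
        simp [T, reassoc_of% h', Preadditive.sub_comp]
      · rw [nullHomotopicMap_up_f]
        simp only [T, if_neg (show ¬ n + 1 ≤ a by lia), if_neg hn.not_ge, comp_zero, zero_comp,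
          add_zero])
  exact ⟨M, r, e, fun n hn => hM n (hlt n hn)⟩

/-- Dual truncation. The boundary degree is `b`, where only `d` followed by `H` survives; it is
idempotent because `H` contracts degree `b + 1`. -/
theorem exists_iso_isZero_gt [IsIdempotentComplete C] {K L : CochainComplex C ℤ}
    {f : K ⟶ L} {g : L ⟶ K} (H : Homotopy (𝟙 K) (f ≫ g)) (b : ℤ)
    (hL : ∀ n, b < n → IsZero (L.X n)) :
    ∃ (M : CochainComplex C ℤ) (_ : Retract M K),
      Nonempty ((HomotopyCategory.quotient C (.up ℤ)).obj M ≅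
        (HomotopyCategory.quotient C (.up ℤ)).obj K) ∧ ∀ n, b < n → IsZero (M.X n) := by
  let T : ∀ i j, K.X i ⟶ K.X j := fun i j => if b < i then H.hom i j else 0
  have hlt : ∀ n, b < n → (Homotopy.nullHomotopicMap T).f n = 𝟙 _ := fun n hn => by
    rw [nullHomotopicMap_up_f, ← homotopy_up_comm H (hL n hn)]
    simp only [T, if_pos (show b < n + 1 by lia), if_pos hn]
  obtain ⟨M, r, e, hM⟩ := exists_retract_of_idempotent_id_sub_nullHomotopicMap T
    (fun i j hij => by simp only [T, H.zero i j hij, ite_self]) (fun n => by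
      rcases lt_trichotomy b n with hn | rfl | hn
      · rw [hlt n hn, Category.comp_id]
      · have h := homotopy_up_comm H (hL (b + 1) (by lia))
        rw [add_sub_cancel_right] at h
        have h' : H.hom (b + 1) b ≫ K.d b (b + 1) =
            𝟙 _ - K.d (b + 1) (b + 1 + 1) ≫ H.hom (b + 1 + 1) (b + 1) := by
          rw [← h]; abel
        rw [nullHomotopicMap_up_f]
        simp [T, reassoc_of% h', Preadditive.sub_comp]
      · rw [nullHomotopicMap_up_f]
        simp only [T, if_neg (show ¬ b < n + 1 by lia), if_neg hn.not_gt, comp_zero, zero_comp,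
          add_zero])
  exact ⟨M, r, e, fun n hn => hM n (hlt n hn)⟩

theorem exists_homotopy_of_retract {K L : CochainComplex C ℤ}
    (r : Retract ((HomotopyCategory.quotient C (.up ℤ)).obj K)
      ((HomotopyCategory.quotient C (.up ℤ)).obj L)) :
    ∃ (f : K ⟶ L) (g : L ⟶ K), Nonempty (Homotopy (𝟙 K) (f ≫ g)) := by
  obtain ⟨f, hf⟩ := (HomotopyCategory.quotient C (.up ℤ)).map_surjective r.i
  obtain ⟨g, hg⟩ := (HomotopyCategory.quotient C (.up ℤ)).map_surjective r.r
  refine ⟨f, g, ⟨HomotopyCategory.homotopyOfEq _ _ ?_⟩⟩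
  rw [Functor.map_comp, hf, hg, r.retract, CategoryTheory.Functor.map_id]

/-- A homotopy retract of a complex concentrated in degrees `[a, b]` is homotopy equivalent to
a complex concentrated in the same degrees. -/
theorem exists_iso_isZero_outside [IsIdempotentComplete C] {K L : CochainComplex C ℤ}
    (r : Retract ((HomotopyCategory.quotient C (.up ℤ)).obj K)
      ((HomotopyCategory.quotient C (.up ℤ)).obj L)) (a b : ℤ)
    (ha : ∀ n < a, IsZero (L.X n)) (hb : ∀ n, b < n → IsZero (L.X n)) :
    ∃ M : CochainComplex C ℤ,
      Nonempty ((HomotopyCategory.quotient C (.up ℤ)).obj M ≅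
        (HomotopyCategory.quotient C (.up ℤ)).obj K) ∧
      (∀ n < a, IsZero (M.X n)) ∧ ∀ n, b < n → IsZero (M.X n) := by
  obtain ⟨f, g, ⟨H⟩⟩ := exists_homotopy_of_retract r
  obtain ⟨M, -, ⟨e⟩, hM⟩ := exists_iso_isZero_lt H a ha
  obtain ⟨f', g', ⟨H'⟩⟩ := exists_homotopy_of_retract ((Retract.ofIso e).trans r)
  obtain ⟨M', r', ⟨e'⟩, hM'⟩ := exists_iso_isZero_gt H' b hb
  exact ⟨M', ⟨e' ≪≫ e⟩, fun n hn => (hM n hn).of_retract (cochainRetractEval r' n), hM'⟩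

theorem complexLength_le_of_isZero {K : CochainComplex C ℤ} {a b : ℤ}
    (ha : ∀ n < a, IsZero (K.X n)) (hb : ∀ n, b < n → IsZero (K.X n)) :
    complexLength K ≤ ((b - a).toNat : ℕ∞) := by
  refine iSup_le fun i => iSup_le fun j => iSup_le fun hi => iSup_le fun hj => ?_
  have h1 : a ≤ i := not_lt.1 fun h => hi (ha i h)
  have h2 : j ≤ b := not_lt.1 fun h => hj (hb j h)
  exact_mod_cast Int.toNat_le_toNat (by lia)

theorem le_complexLength {K : CochainComplex C ℤ} {a b : ℤ}
    (ha : ¬ IsZero (K.X a)) (hb : ¬ IsZero (K.X b)) :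
    ((b - a).toNat : ℕ∞) ≤ complexLength K :=
  le_iSup_of_le a <| le_iSup_of_le b <| le_iSup_of_le ha <| le_iSup_of_le hb le_rfl

theorem complexLength_mono {D : Type*} [Category D] [Preadditive D] {K : CochainComplex C ℤ}
    {L : CochainComplex D ℤ} (h : ∀ n, IsZero (L.X n) → IsZero (K.X n)) :
    complexLength K ≤ complexLength L :=
  iSup_le fun _ => iSup_le fun _ => iSup_le fun hi => iSup_le fun hj =>
    le_complexLength (fun h' => hi (h _ h')) (fun h' => hj (h _ h'))

/-- A complex of finite length which is not termwise zero is concentrated in an interval of that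
length. -/
theorem exists_bounds_of_complexLength_ne_top {K : CochainComplex C ℤ}
    (hK : complexLength K ≠ ⊤) {m : ℤ} (hm : ¬ IsZero (K.X m)) :
    ∃ a b : ℤ, (∀ n < a, IsZero (K.X n)) ∧ (∀ n, b < n → IsZero (K.X n)) ∧
      ((b - a).toNat : ℕ∞) = complexLength K := by
  obtain ⟨l, hl⟩ := ENat.ne_top_iff_exists.1 hK
  have key : ∀ i j, ¬ IsZero (K.X i) → ¬ IsZero (K.X j) → (j - i).toNat ≤ l := fun i j hi hj => by
    have := le_complexLength hi hj
    rw [← hl] at this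
    exact_mod_cast this
  obtain ⟨b, hb, hb'⟩ := Int.exists_greatest_of_bdd (P := fun n => ¬ IsZero (K.X n))
    ⟨m + l, fun n hn => by have := key m n hm hn; lia⟩ ⟨m, hm⟩
  obtain ⟨a, ha, ha'⟩ := Int.exists_least_of_bdd (P := fun n => ¬ IsZero (K.X n))
    ⟨m - l, fun n hn => by have := key n m hn hm; lia⟩ ⟨m, hm⟩
  have h1 : ∀ n < a, IsZero (K.X n) := fun n hn => not_not.1 fun h => by have := ha' n h; lia
  have h2 : ∀ n, b < n → IsZero (K.X n) := fun n hn => not_not.1 fun h => by have := hb' n h; lia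
  exact ⟨a, b, h1, h2, le_antisymm (le_complexLength ha hb) (complexLength_le_of_isZero h1 h2)⟩

/-- Any representative of `X` of finite length lies in an interval, and `P` can be trimmed to that
same interval. -/
theorem BoundedHomotopyCategory.length_le_of_retract [IsIdempotentComplete C]
    {P X : BoundedHomotopyCategory C} (r : Retract P X) : P.length ≤ X.length := by
  refine le_iInf fun Q => le_iInf fun ⟨e⟩ => ?_
  have r' : Retract P.obj ((HomotopyCategory.quotient C (.up ℤ)).obj Q) :=
    (r.map (isBoundedComplex C).ι).trans (Retract.ofIso e.symm)
  by_cases hQ : complexLength Q = ⊤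
  · exact hQ ▸ le_top
  by_cases h0 : ∀ n, IsZero (Q.X n)
  -- A termwise zero `Q` has no extreme degrees to trim to, but then `P` is zero as well and `Q`
  -- itself represents it.
  · have hQ0 : IsZero Q := by
      rw [IsZero.iff_id_eq_zero]
      ext n
      exact (h0 n).eq_of_src _ _
    have hQ1 := (HomotopyCategory.quotient C (.up ℤ)).map_isZero hQ0
    exact iInf_le_of_le Q (iInf_le _ ⟨hQ1.iso (hQ1.of_retract r')⟩)
  · push Not at h0
    obtain ⟨m, hm⟩ := h0
    obtain ⟨a, b, ha, hb, hab⟩ := exists_bounds_of_complexLength_ne_top hQ hm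
    obtain ⟨M, ⟨e⟩, hMa, hMb⟩ := exists_iso_isZero_outside (K := P.obj.as) r' a b ha hb
    rw [← hab]
    exact iInf_le_of_le M (iInf_le_of_le ⟨e⟩ (complexLength_le_of_isZero hMa hMb))

end Truncation

/-! ### Fitting's lemma in a finite-dimensional algebra -/

section Fitting

open Polynomial in
/-- A polynomial form of Fitting's lemma. -/
theorem exists_isIdempotentElem_of_finiteDimensional (k : Type*) [Field k] {R : Type*} [Ring R]
    [Algebra k R] [Module.Finite k R] (f : R) :
    ∃ (n : ℕ) (e g : R), e * e = e ∧ f * g = e ∧ g * f = e ∧ f ^ n * e = f ^ n := by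
  obtain ⟨p, hp, hpf⟩ : ∃ p : k[X], p ≠ 0 ∧ aeval f p = 0 :=
    ⟨minpoly k f, minpoly.ne_zero (Algebra.IsIntegral.isIntegral f), minpoly.aeval k f⟩
  obtain ⟨q, hq, hdvd⟩ := p.exists_eq_pow_rootMultiplicity_mul_and_not_dvd hp 0
  set n := p.rootMultiplicity 0
  rw [C_0, sub_zero] at hq hdvd
  -- Here `p = X ^ n * q` kills `f` and `X` does not divide `q`. From `a * X ^ (n + 1) + b * q = 1`,
  -- the value of `a * X ^ (n + 1)` at `f` is idempotent. The exponent `n + 1` leaves a factor `X`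
  -- to remove even when `n = 0`, which produces the inverse `g` of `f` on the image of `e`.
  obtain ⟨a, b, hab⟩ : IsCoprime (X ^ (n + 1)) q :=
    (((irreducible_X (R := k)).coprime_iff_not_dvd).2 hdvd).pow_left
  have hz (r : k[X]) : aeval f (r * (X ^ n * q)) = 0 := by rw [← hq, map_mul, hpf, mul_zero]
  have hX : aeval f (X : k[X]) = f := aeval_X f
  refine ⟨n, aeval f (a * X ^ (n + 1)), aeval f (a * X ^ n), ?_, ?_, ?_, ?_⟩
  · rw [← map_mul, show a * X ^ (n + 1) * (a * X ^ (n + 1)) =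
      a * X ^ (n + 1) + (-(a * X * b)) * (X ^ n * q) by
        linear_combination (a * X ^ (n + 1)) * hab, map_add, hz, add_zero]
  · rw [show a * X ^ (n + 1) = X * (a * X ^ n) by ring, map_mul (aeval f) X, hX]
  · rw [show a * X ^ (n + 1) = (a * X ^ n) * X by ring, map_mul (aeval f) _ X, hX]
  · have hXn : aeval f (X ^ n : k[X]) = f ^ n := by rw [map_pow, hX]
    rw [← hXn, ← map_mul, show X ^ n * (a * X ^ (n + 1)) = X ^ n + (-b) * (X ^ n * q) by
        linear_combination (X ^ n) * hab, map_add, hz, add_zero]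

end Fitting

/-! ### Endomorphism rings of indecomposable objects are local -/

section KrullSchmidt

universe v u

variable {C : Type u} [Category.{v} C] [Preadditive C]

/-- Inserting `h` between `r.i` and `s.r` gives `x + x = x` for `x = r.i ≫ s.r`, so the cross terms
vanish and `P` is the biproduct of `Y` and `Z`. -/
theorem CategoryTheory.Indecomposable.isZero_or_isZero [HasBinaryBiproducts C] {P Y Z : C}
    (hP : Indecomposable P) (r : Retract Y P) (s : Retract Z P)
    (h : r.r ≫ r.i + s.r ≫ s.i = 𝟙 P) : IsZero Y ∨ IsZero Z := by
  have h1 : r.i ≫ s.r = 0 := by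
    have h2 := congr(r.i ≫ $h ≫ s.r)
    simp only [Preadditive.add_comp, Preadditive.comp_add, Category.assoc, s.retract,
      Category.comp_id, Category.id_comp, reassoc_of% r.retract] at h2
    simpa using h2
  have h3 : s.i ≫ r.r = 0 := by
    have h2 := congr(s.i ≫ $h ≫ r.r)
    simp only [Preadditive.add_comp, Preadditive.comp_add, Category.assoc, r.retract,
      Category.comp_id, Category.id_comp, reassoc_of% s.retract] at h2
    simpa using h2
  exact hP.2 Y Z ⟨biprod.lift r.r s.r, biprod.desc r.i s.i, by simpa using h, by
    ext <;> simp [h1, h3, r.retract, s.retract]⟩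

variable (k : Type*) [Field k] [Linear k C]

theorem finite_hom_cochainComplex (hC : ∀ X Y : C, Module.Finite k (X ⟶ Y))
    (K L : CochainComplex C ℤ) {a b : ℤ} (ha : ∀ n < a, IsZero (K.X n))
    (hb : ∀ n, b < n → IsZero (K.X n)) : Module.Finite k (K ⟶ L) := by
  let φ : (K ⟶ L) →ₗ[k] (∀ n : Set.Icc a b, K.X n ⟶ L.X n) :=
    { toFun f n := f.f n
      map_add' _ _ := rfl
      map_smul' _ _ := rfl }
  refine Module.Finite.of_injective φ fun f g hfg => ?_
  ext n
  by_cases h1 : n < a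
  · exact (ha n h1).eq_of_src _ _
  by_cases h2 : b < n
  · exact (hb n h2).eq_of_src _ _
  exact congr_fun hfg ⟨n, not_lt.1 h1, not_lt.1 h2⟩

theorem BoundedHomotopyCategory.exists_bounds (P : BoundedHomotopyCategory C) :
    ∃ a b : ℤ, (∀ n < a, IsZero (P.obj.as.X n)) ∧ ∀ n, b < n → IsZero (P.obj.as.X n) := by
  obtain ⟨a, b, _, _⟩ := P.property
  exact ⟨a, b, fun n hn => CochainComplex.isZero_of_isStrictlyGE _ a n hn,
    fun n hn => CochainComplex.isZero_of_isStrictlyLE _ b n hn⟩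

theorem finite_hom_boundedHomotopyCategory (hC : ∀ X Y : C, Module.Finite k (X ⟶ Y))
    (P Q : BoundedHomotopyCategory C) : Module.Finite k (P ⟶ Q) := by
  obtain ⟨a, b, ha, hb⟩ := P.exists_bounds
  have := finite_hom_cochainComplex k hC P.obj.as Q.obj.as ha hb
  let φ : (P.obj.as ⟶ Q.obj.as) →ₗ[k] (P ⟶ Q) :=
    { toFun f := ObjectProperty.homMk ((HomotopyCategory.quotient C (.up ℤ)).map f)
      map_add' _ _ := rfl
      map_smul' _ _ := rfl }
  refine Module.Finite.of_surjective φ fun f => ?_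
  obtain ⟨g, hg⟩ := (HomotopyCategory.quotient C (.up ℤ)).map_surjective f.hom
  exact ⟨g, ObjectProperty.hom_ext _ hg⟩

/-- The object of `K^b(C)` given by a retract of a bounded complex. -/
def BoundedHomotopyCategory.ofRetract (P : BoundedHomotopyCategory C) {K : CochainComplex C ℤ}
    (r : Retract K P.obj.as) : BoundedHomotopyCategory C :=
  ⟨(HomotopyCategory.quotient C (.up ℤ)).obj K, by
    obtain ⟨a, b, ha, hb⟩ := P.exists_bounds
    refine ⟨a, b, ?_, ?_⟩
    · rw [CochainComplex.isStrictlyGE_iff]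
      exact fun n hn => (ha n hn).of_retract (cochainRetractEval r n)
    · rw [CochainComplex.isStrictlyLE_iff]
      exact fun n hn => (hb n hn).of_retract (cochainRetractEval r n)⟩

/-- A retract of the underlying complex gives a retract in `K^b(C)`. -/
def BoundedHomotopyCategory.retractOfRetract (P : BoundedHomotopyCategory C)
    {K : CochainComplex C ℤ} (r : Retract K P.obj.as) : Retract (P.ofRetract r) P where
  i := ObjectProperty.homMk ((HomotopyCategory.quotient C (.up ℤ)).map r.i)
  r := ObjectProperty.homMk ((HomotopyCategory.quotient C (.up ℤ)).map r.r)
  retract := by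
    ext
    exact (r.map (HomotopyCategory.quotient C (.up ℤ))).retract

/-- Fitting's lemma is applied to a chain-level lift of `f`, not to its homotopy class. The
idempotent is then an honest chain map, and it splits because `C` is idempotent complete; no
splitting of idempotents in `K^b(C)` is needed. -/
theorem isUnit_or_isNilpotent_of_indecomposable [HasBinaryBiproducts C] [IsIdempotentComplete C]
    (hC : ∀ X Y : C, Module.Finite k (X ⟶ Y)) {P : BoundedHomotopyCategory C}
    (hP : Indecomposable P) (f : End P) : IsUnit f ∨ IsNilpotent f := by
  obtain ⟨a, b, ha, hb⟩ := P.exists_bounds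
  have : Module.Finite k (End P.obj.as) := finite_hom_cochainComplex k hC P.obj.as P.obj.as ha hb
  let φ : End P.obj.as →* End P :=
    { toFun f := ObjectProperty.homMk ((HomotopyCategory.quotient C (.up ℤ)).map f)
      map_one' := ObjectProperty.hom_ext _
        ((HomotopyCategory.quotient C (.up ℤ)).map_id P.obj.as)
      map_mul' f g := ObjectProperty.hom_ext _
        ((HomotopyCategory.quotient C (.up ℤ)).map_comp g f) }
  obtain ⟨f, rfl⟩ : ∃ f', φ f' = f := by
    obtain ⟨g, hg⟩ := (HomotopyCategory.quotient C (.up ℤ)).map_surjective f.hom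
    exact ⟨g, ObjectProperty.hom_ext _ hg⟩
  obtain ⟨n, e, g, he, hfg, hgf, hn⟩ := exists_isIdempotentElem_of_finiteDimensional k f
  have he' : (1 - e) * (1 - e) = 1 - e := by simp [mul_sub, sub_mul, he]
  obtain ⟨Y, i, p, hip, hpi⟩ := IsIdempotentComplete.idempotents_split P.obj.as e he
  obtain ⟨Z, i', p', hip', hpi'⟩ := IsIdempotentComplete.idempotents_split P.obj.as (1 - e) he'
  let r : Retract Y P.obj.as := ⟨i, p, hip⟩
  let s : Retract Z P.obj.as := ⟨i', p', hip'⟩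
  have hr : (P.retractOfRetract r).r ≫ (P.retractOfRetract r).i = φ e := by
    ext
    exact ((HomotopyCategory.quotient C (.up ℤ)).map_comp _ _).symm.trans (congrArg _ hpi)
  have hs : (P.retractOfRetract s).r ≫ (P.retractOfRetract s).i = φ (1 - e) := by
    ext
    exact ((HomotopyCategory.quotient C (.up ℤ)).map_comp _ _).symm.trans (congrArg _ hpi')
  have hφ : φ e + φ (1 - e) = 1 := by
    refine ObjectProperty.hom_ext _ (((HomotopyCategory.quotient C (.up ℤ)).map_add).symm.trans ?_)
    exact (congrArg _ (add_sub_cancel e 1)).trans (CategoryTheory.Functor.map_id _ _)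
  rcases hP.isZero_or_isZero (P.retractOfRetract r) (P.retractOfRetract s)
    (by rw [hr, hs]; exact hφ) with h | h
  · right
    have h0 : φ e = 0 := by rw [← hr, h.eq_of_tgt (P.retractOfRetract r).r 0, zero_comp]
    exact ⟨n, by rw [← map_pow, ← hn, map_mul, h0, mul_zero]⟩
  · left
    have h0 : φ (1 - e) = 0 := by
      rw [← hs, h.eq_of_tgt (P.retractOfRetract s).r 0, zero_comp]
    rw [h0, add_zero] at hφ
    exact ⟨⟨φ f, φ g, by rw [← map_mul, hfg, hφ], by rw [← map_mul, hgf, hφ]⟩, rfl⟩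

theorem isUnit_or_isUnit_of_indecomposable [HasBinaryBiproducts C] [IsIdempotentComplete C]
    (hC : ∀ X Y : C, Module.Finite k (X ⟶ Y)) {P : BoundedHomotopyCategory C}
    (hP : Indecomposable P) {f g : End P} (h : f + g = 1) : IsUnit f ∨ IsUnit g := by
  refine (isUnit_or_isNilpotent_of_indecomposable k hC hP f).imp_right fun hf => ?_
  rw [← eq_sub_iff_add_eq'] at h
  exact h ▸ hf.isUnit_one_sub

end KrullSchmidt

/-! ### Transferring indecomposables along a pair of additive functors -/

section RetractTransfer

universe v u v' u'

variable {C : Type u} [Category.{v} C] [Preadditive C] {D : Type u'} [Category.{v'} D]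
  [Preadditive D]

/-- The functor `K^b(C) ⥤ K^b(D)` induced by an additive functor `C ⥤ D`. -/
def CategoryTheory.Functor.mapBoundedHomotopyCategory (G : C ⥤ D) [G.Additive] :
    BoundedHomotopyCategory C ⥤ BoundedHomotopyCategory D :=
  ObjectProperty.lift _ ((isBoundedComplex C).ι ⋙ G.mapHomotopyCategory (.up ℤ)) fun P => by
    obtain ⟨a, b, ha, hb⟩ := P.exists_bounds
    refine ⟨a, b, ?_, ?_⟩
    · rw [CochainComplex.isStrictlyGE_iff]
      exact fun n hn => G.map_isZero (ha n hn)
    · rw [CochainComplex.isStrictlyLE_iff]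
      exact fun n hn => G.map_isZero (hb n hn)

instance (G : C ⥤ D) [G.Additive] : G.mapBoundedHomotopyCategory.Additive where
  map_add {_ _ f g} := by
    ext
    exact (G.mapHomotopyCategory (.up ℤ)).map_add (f := f.hom) (g := g.hom)

theorem length_mapBoundedHomotopyCategory_le (G : C ⥤ D) [G.Additive]
    (P : BoundedHomotopyCategory C) : (G.mapBoundedHomotopyCategory.obj P).length ≤ P.length := by
  refine le_iInf fun Q => le_iInf fun ⟨e⟩ => ?_
  refine iInf_le_of_le ((G.mapHomologicalComplex (.up ℤ)).obj Q)
    (iInf_le_of_le ⟨(G.mapHomotopyCategory (.up ℤ)).mapIso e⟩ ?_)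
  exact complexLength_mono fun n hn => G.map_isZero hn

/-- A natural retraction of `F ⋙ G` onto the identity passes to bounded homotopy categories. -/
def mapBoundedHomotopyCategoryRetract (F : C ⥤ D) (G : D ⥤ C) [F.Additive] [G.Additive]
    (r : Retract (𝟭 C) (F ⋙ G)) (P : BoundedHomotopyCategory C) :
    Retract P (G.mapBoundedHomotopyCategory.obj (F.mapBoundedHomotopyCategory.obj P)) := by
  let K : CochainComplex C ℤ := P.obj.as
  let L : CochainComplex C ℤ :=
    (G.mapHomologicalComplex (.up ℤ)).obj ((F.mapHomologicalComplex (.up ℤ)).obj K)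
  let s : Retract K L :=
    { i := { f n := r.i.app (K.X n), comm' i j _ := (r.i.naturality (K.d i j)).symm }
      r := { f n := r.r.app (K.X n), comm' i j _ := (r.r.naturality (K.d i j)).symm }
      retract := by
        ext n
        exact congr_app r.retract (K.X n) }
  let t := s.map (HomotopyCategory.quotient C (.up ℤ))
  exact ⟨ObjectProperty.homMk t.i, ObjectProperty.homMk t.r, by ext; exact t.retract⟩

variable (k : Type*) [Field k] [Linear k C] [Linear k D]

/-- By locality one of the two summands is an automorphism of `P`; correcting by its inverse
exhibits the retract. -/
theorem retract_or_retract_of_add_eq_id [HasBinaryBiproducts C] [IsIdempotentComplete C]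
    (hC : ∀ X Y : C, Module.Finite k (X ⟶ Y)) {P Y Z : BoundedHomotopyCategory C}
    (hP : Indecomposable P) {i : P ⟶ Y} {p : Y ⟶ P} {j : P ⟶ Z} {q : Z ⟶ P}
    (h : i ≫ p + j ≫ q = 𝟙 P) : Nonempty (Retract P Y) ∨ Nonempty (Retract P Z) := by
  have key {W : BoundedHomotopyCategory C} (i : P ⟶ W) (p : W ⟶ P)
      (hu : IsUnit (M := End P) (i ≫ p)) : Nonempty (Retract P W) := by
    obtain ⟨g, hg⟩ := hu.exists_left_inv
    exact ⟨⟨i, p ≫ g, by rw [← Category.assoc]; exact hg⟩⟩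
  exact (isUnit_or_isUnit_of_indecomposable k hC hP h).imp (key i p) (key j q)

theorem CategoryTheory.Linear.finrank_end_pos {X : C} [Module.Finite k (X ⟶ X)]
    (hX : ¬ IsZero X) : 0 < Module.finrank k (X ⟶ X) := by
  rw [IsZero.iff_id_eq_zero] at hX
  have : Nontrivial (X ⟶ X) := ⟨_, _, hX⟩
  exact Module.finrank_pos

/-- Block-diagonal endomorphisms embed `End Y × End Z` in `End X`, and `End Z ≠ 0`. This makes `dim
End` a terminating measure for splitting off summands. -/
theorem CategoryTheory.Linear.finrank_end_lt_biprod [HasBinaryBiproducts C]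
    (hC : ∀ X Y : C, Module.Finite k (X ⟶ Y)) {X Y Z : C} (e : X ≅ Y ⊞ Z) (hZ : ¬ IsZero Z) :
    Module.finrank k (Y ⟶ Y) < Module.finrank k (X ⟶ X) := by
  let φ : ((Y ⟶ Y) × (Z ⟶ Z)) →ₗ[k] (X ⟶ X) :=
    { toFun f := e.hom ≫ biprod.map f.1 f.2 ≫ e.inv
      map_add' f g := by
        rw [← Preadditive.comp_add, ← Preadditive.add_comp]
        congr 2
        ext <;> simp
      map_smul' c f := by
        simp only [RingHom.id_apply]
        rw [← Linear.comp_smul, ← Linear.smul_comp]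
        congr 2
        ext <;> simp }
  have hφ : Function.Injective φ := fun f g hfg => by
    have h : biprod.map f.1 f.2 = biprod.map g.1 g.2 := by
      simpa [φ] using hfg
    ext
    · simpa using congr(biprod.inl ≫ $h ≫ biprod.fst)
    · simpa using congr(biprod.inr ≫ $h ≫ biprod.snd)
  have := LinearMap.finrank_le_finrank_of_injective hφ
  rw [Module.finrank_prod] at this
  have := Linear.finrank_end_pos k hZ
  lia

/-- Induction on `dim End Q`. If `Q` splits as `Y ⊞ Z`, the identity of `P` is a sum of maps through
the images of `Y` and `Z`, so locality makes `P` a retract of one of these images. -/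
theorem exists_indecomposable_retract [HasBinaryBiproducts C] [HasBinaryBiproducts D]
    [IsIdempotentComplete C] (hC : ∀ X Y : C, Module.Finite k (X ⟶ Y))
    (hD : ∀ X Y : D, Module.Finite k (X ⟶ Y)) (G : D ⥤ C) [G.Additive]
    {P : BoundedHomotopyCategory C} (hP : Indecomposable P) (Q : BoundedHomotopyCategory D)
    (hQ : Nonempty (Retract P (G.mapBoundedHomotopyCategory.obj Q))) :
    ∃ Q' : BoundedHomotopyCategory D, Indecomposable Q' ∧
      Nonempty (Retract P (G.mapBoundedHomotopyCategory.obj Q')) := by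
  have hD' := finite_hom_boundedHomotopyCategory k hD
  induction h : Module.finrank k (Q ⟶ Q) using Nat.strong_induction_on generalizing Q with
  | h n ih =>
  obtain ⟨r⟩ := hQ
  by_cases hind : Indecomposable Q
  · exact ⟨Q, hind, ⟨r⟩⟩
  have hQ0 : ¬ IsZero Q := fun h =>
    hP.1 ((G.mapBoundedHomotopyCategory.map_isZero h).of_retract r)
  simp only [Indecomposable, hQ0, not_false_eq_true, true_and, not_forall, not_or] at hind
  obtain ⟨Y, Z, e, hY, hZ⟩ := hind
  let H := G.mapBoundedHomotopyCategory
  have hsum : (r.i ≫ H.map (e.hom ≫ biprod.fst)) ≫ (H.map (biprod.inl ≫ e.inv) ≫ r.r) +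
      (r.i ≫ H.map (e.hom ≫ biprod.snd)) ≫ (H.map (biprod.inr ≫ e.inv) ≫ r.r) = 𝟙 P := by
    have h1 : (e.hom ≫ biprod.fst) ≫ (biprod.inl ≫ e.inv) +
        (e.hom ≫ biprod.snd) ≫ (biprod.inr ≫ e.inv) = 𝟙 Q := by
      have := congr(e.hom ≫ $(biprod.total (X := Y) (Y := Z)) ≫ e.inv)
      simpa only [Preadditive.add_comp, Preadditive.comp_add, Category.assoc, Category.id_comp,
        e.hom_inv_id] using this
    have h2 := congr(r.i ≫ H.map $h1 ≫ r.r)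
    rw [H.map_add, H.map_comp (_ ≫ _), H.map_comp (e.hom ≫ biprod.snd)] at h2
    have h3 : r.i ≫ H.map (𝟙 Q) ≫ r.r = 𝟙 P := by
      rw [H.map_id]
      exact (congrArg _ (Category.id_comp _)).trans r.retract
    simpa only [Preadditive.add_comp, Preadditive.comp_add, Category.assoc] using h2.trans h3
  rcases retract_or_retract_of_add_eq_id k hC hP hsum with h' | h'
  · exact ih _ (h ▸ Linear.finrank_end_lt_biprod k hD' e hZ) Y h' rfl
  · exact ih _ (h ▸ Linear.finrank_end_lt_biprod k hD' (e ≪≫ biprod.braiding Y Z) hY) Z h' rfl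

theorem iSup_length_le_iSup_length [HasBinaryBiproducts C] [HasBinaryBiproducts D]
    [IsIdempotentComplete C] (hC : ∀ X Y : C, Module.Finite k (X ⟶ Y))
    (hD : ∀ X Y : D, Module.Finite k (X ⟶ Y)) (F : C ⥤ D) (G : D ⥤ C) [F.Additive] [G.Additive]
    (r : Retract (𝟭 C) (F ⋙ G)) :
    ⨆ (P : BoundedHomotopyCategory C) (_ : Indecomposable P), P.length ≤
      ⨆ (P : BoundedHomotopyCategory D) (_ : Indecomposable P), P.length := by
  refine iSup_le fun P => iSup_le fun hP => ?_
  obtain ⟨Q, hQ, ⟨s⟩⟩ := exists_indecomposable_retract k hC hD G hP _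
    ⟨mapBoundedHomotopyCategoryRetract F G r P⟩
  exact le_iSup_of_le Q (le_iSup_of_le hQ
    ((BoundedHomotopyCategory.length_le_of_retract s).trans
      (length_mapBoundedHomotopyCategory_le G Q)))

end RetractTransfer

/-! ### Induction from `A` to `A ⊗ K`, its unit and its counit -/

section BaseChange

variable (k : Type*) (K : Type*) {A : Type*} [Field k] [Field K] [Algebra k K] [Ring A]
  [Algebra k A]

/-- The abelian group `M ⊗[k] K`, regarded as a left `A ⊗[k] K`-module for a left `A`-module
`M`. -/
def BaseChange (M : Type*) [AddCommGroup M] [Module k M] := M ⊗[k] K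

namespace BaseChange

section Basic

variable {M : Type*} [AddCommGroup M] [Module k M]

instance : AddCommGroup (BaseChange k K M) := inferInstanceAs (AddCommGroup (M ⊗[k] K))

/-- The pure tensor `m ⊗ x`. -/
def mk (m : M) (x : K) : BaseChange k K M := m ⊗ₜ[k] x

variable {k K}

@[elab_as_elim]
theorem induction_on {p : BaseChange k K M → Prop} (z : BaseChange k K M)
    (tmul : ∀ m x, p (mk k K m x)) (add : ∀ y z, p y → p z → p (y + z)) : p z :=
  TensorProduct.induction_on z (by simpa [mk, TensorProduct.zero_tmul] using! tmul 0 0) tmul add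

theorem mk_add_left (m n : M) (x : K) : mk k K (m + n) x = mk k K m x + mk k K n x :=
  TensorProduct.add_tmul m n x

variable [Module A M] [IsScalarTower k A M]

variable (k K A M) in
/-- The action of `A ⊗[k] K` on `M ⊗[k] K`. -/
def action : A ⊗[k] K →ₐ[k] Module.End k (M ⊗[k] K) :=
  (Module.endTensorEndAlgHom (S := k) (A := k)).comp
    (Algebra.TensorProduct.map (Algebra.lsmul k k M) (Algebra.lmul k K))

instance : Module (A ⊗[k] K) (BaseChange k K M) :=
  Module.compHom (M ⊗[k] K) (action k K A M).toRingHom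

theorem tmul_smul_mk (a : A) (x : K) (m : M) (y : K) :
    (a ⊗ₜ[k] x : A ⊗[k] K) • mk k K m y = mk k K (a • m) (x * y) := rfl

theorem tmul_one_smul_mk (a : A) (m : M) (y : K) :
    (a ⊗ₜ[k] (1 : K) : A ⊗[k] K) • mk k K m y = mk k K (a • m) y := by
  rw [tmul_smul_mk, one_mul]

theorem one_tmul_smul_mk_one (m : M) (y : K) :
    ((1 : A) ⊗ₜ[k] y : A ⊗[k] K) • mk k K m 1 = mk k K m y := by
  rw [tmul_smul_mk, one_smul, mul_one]

theorem algebraMap_tmul_eq (r : k) (x : K) :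
    (algebraMap k A r ⊗ₜ[k] x : A ⊗[k] K) = 1 ⊗ₜ[k] (r • x) := by
  rw [Algebra.algebraMap_eq_smul_one, TensorProduct.smul_tmul]

variable {Y : Type*} [AddCommGroup Y] [Module (A ⊗[k] K) Y]

/-- The `A ⊗[k] K`-linear map out of `M ⊗[k] K` induced by an `A`-linear map out of `M`. -/
def lift (g : M →+ Y) (hg : ∀ (a : A) m, g (a • m) = (a ⊗ₜ[k] (1 : K) : A ⊗[k] K) • g m) :
    BaseChange k K M →ₗ[A ⊗[k] K] Y :=
  let φ : BaseChange k K M →+ Y := TensorProduct.liftAddHom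
    { toFun m :=
        { toFun x := ((1 : A) ⊗ₜ[k] x : A ⊗[k] K) • g m
          map_zero' := by rw [TensorProduct.tmul_zero, zero_smul]
          map_add' x y := by rw [TensorProduct.tmul_add, add_smul] }
      map_zero' := by ext x; simp
      map_add' m n := by ext x; simp }
    (fun r m x => by
      change ((1 : A) ⊗ₜ[k] x : A ⊗[k] K) • g (r • m) =
        ((1 : A) ⊗ₜ[k] (r • x) : A ⊗[k] K) • g m
      rw [← algebraMap_smul A r m, hg, smul_smul, Algebra.TensorProduct.tmul_mul_tmul, one_mul,
        mul_one, algebraMap_tmul_eq])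
  have hφ (m : M) (x : K) : φ (mk k K m x) = ((1 : A) ⊗ₜ[k] x : A ⊗[k] K) • g m := rfl
  { φ with
    map_smul' b z := by
      change φ (b • z) = b • φ z
      induction b with
      | zero => simp
      | add b c hb hc => rw [add_smul, map_add, hb, hc, add_smul]
      | tmul a x =>
        induction z using induction_on with
        | add y z hy hz => rw [smul_add, map_add, hy, hz, map_add, smul_add]
        | tmul m y =>
          rw [tmul_smul_mk, hφ, hφ, hg, smul_smul, smul_smul,
            Algebra.TensorProduct.tmul_mul_tmul, Algebra.TensorProduct.tmul_mul_tmul,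
            one_mul, mul_one, mul_one] }

theorem lift_mk (g : M →+ Y)
    (hg : ∀ (a : A) m, g (a • m) = (a ⊗ₜ[k] (1 : K) : A ⊗[k] K) • g m) (m : M) (x : K) :
    lift g hg (mk k K m x) = ((1 : A) ⊗ₜ[k] x : A ⊗[k] K) • g m := rfl

theorem lift_mk_one (g : M →+ Y)
    (hg : ∀ (a : A) m, g (a • m) = (a ⊗ₜ[k] (1 : K) : A ⊗[k] K) • g m) (m : M) :
    lift g hg (mk k K m 1) = g m := by
  rw [lift_mk, ← Algebra.TensorProduct.one_def, one_smul]

theorem hom_ext {f g : BaseChange k K M →ₗ[A ⊗[k] K] Y}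
    (h : ∀ m, f (mk k K m 1) = g (mk k K m 1)) : f = g := by
  ext z
  induction z using induction_on with
  | add y z hy hz => rw [map_add, hy, hz, map_add]
  | tmul m x => rw [← one_tmul_smul_mk_one (A := A), map_smul, map_smul, h]

end Basic

section Map

variable {M N P : Type*} [AddCommGroup M] [Module k M] [Module A M] [IsScalarTower k A M]
  [AddCommGroup N] [Module k N] [Module A N] [IsScalarTower k A N]
  [AddCommGroup P] [Module k P] [Module A P] [IsScalarTower k A P]

variable {k K}

variable (k K M) in
/-- The map `m ↦ m ⊗ 1`. -/
def unit : M →+ BaseChange k K M where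
  toFun m := mk k K m 1
  map_zero' := TensorProduct.zero_tmul _ _
  map_add' m n := mk_add_left m n 1

theorem unit_smul (a : A) (m : M) :
    unit k K M (a • m) = (a ⊗ₜ[k] (1 : K) : A ⊗[k] K) • unit k K M m :=
  (tmul_one_smul_mk a m 1).symm

variable (k K) in
/-- Functoriality of base change. -/
def map (f : M →ₗ[A] N) : BaseChange k K M →ₗ[A ⊗[k] K] BaseChange k K N :=
  lift ((unit k K N).comp f.toAddMonoidHom) fun a m => by
    simp [unit_smul]

theorem map_mk (f : M →ₗ[A] N) (m : M) (x : K) : map k K f (mk k K m x) = mk k K (f m) x :=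
  one_tmul_smul_mk_one (A := A) (f m) x

theorem map_id : map k K (LinearMap.id : M →ₗ[A] M) = LinearMap.id :=
  hom_ext fun m => map_mk _ m 1

theorem map_comp (f : M →ₗ[A] N) (g : N →ₗ[A] P) :
    map k K (g ∘ₗ f) = map k K g ∘ₗ map k K f :=
  hom_ext fun m => by simp [map_mk]

theorem map_add (f g : M →ₗ[A] N) : map k K (f + g) = map k K f + map k K g :=
  hom_ext fun m => by simp [map_mk, mk_add_left]

theorem finite [Module.Finite A M] : Module.Finite (A ⊗[k] K) (BaseChange k K M) := by
  obtain ⟨s, hs⟩ := Module.Finite.fg_top (R := A) (M := M)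
  classical
  refine ⟨⟨s.image (unit k K M), eq_top_iff.2 fun z _ => ?_⟩⟩
  have key (m : M) : unit k K M m ∈
      Submodule.span (A ⊗[k] K) (s.image (unit k K M) : Set (BaseChange k K M)) := by
    have hm : m ∈ Submodule.span A (s : Set M) := hs ▸ Submodule.mem_top
    induction hm using Submodule.span_induction with
    | mem m hm => exact Submodule.subset_span (by simpa using ⟨m, hm, rfl⟩)
    | zero => simp
    | add m n _ _ hm hn => rw [_root_.map_add]; exact add_mem hm hn
    | smul a m _ hm => rw [unit_smul]; exact Submodule.smul_mem _ _ hm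
  induction z using induction_on with
  | add y z hy hz => exact add_mem (hy trivial) (hz trivial)
  | tmul m x =>
    rw [← one_tmul_smul_mk_one (A := A)]
    exact Submodule.smul_mem _ _ (key m)

/-- Induction is left adjoint to restriction, which preserves surjections: lift the unit `M → M ⊗ K`
over `A`, then extend the lift to `A ⊗ K`. -/
theorem projective [Module.Projective A M] :
    Module.Projective (A ⊗[k] K) (BaseChange k K M) := by
  refine Module.Projective.of_lifting_property'' fun f hf => ?_
  let φ : A →+* A ⊗[k] K := Algebra.TensorProduct.includeLeftRingHom
  let _ : Module A (BaseChange k K M →₀ A ⊗[k] K) := Module.compHom _ φ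
  let _ : Module A (BaseChange k K M) := Module.compHom _ φ
  let f' : (BaseChange k K M →₀ A ⊗[k] K) →ₗ[A] BaseChange k K M :=
    { f.toAddMonoidHom with map_smul' a z := f.map_smul (φ a) z }
  let u : M →ₗ[A] BaseChange k K M := { unit k K M with map_smul' := unit_smul }
  obtain ⟨h, hh⟩ := Module.projective_lifting_property f' u hf
  have hg (a : A) (m : M) : h.toAddMonoidHom (a • m) =
      (a ⊗ₜ[k] (1 : K) : A ⊗[k] K) • h.toAddMonoidHom m := h.map_smul a m
  refine ⟨lift h.toAddMonoidHom hg, hom_ext fun m => ?_⟩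
  rw [LinearMap.comp_apply, lift_mk_one]
  exact LinearMap.congr_fun hh m

end Map

section Retracts

variable {k K}
variable {M : Type*} [AddCommGroup M] [Module k M] [Module A M] [IsScalarTower k A M]

/-- The `A`-linear map `m ⊗ x ↦ c x • m` for a linear form `c` on `K`. -/
def contract (c : K →ₗ[k] k) : BaseChange k K M →+ M :=
  ((TensorProduct.rid k M).toLinearMap ∘ₗ TensorProduct.map LinearMap.id c).toAddMonoidHom

theorem contract_mk (c : K →ₗ[k] k) (m : M) (x : K) : contract c (mk k K m x) = c x • m :=
  rfl

theorem contract_tmul_one_smul (c : K →ₗ[k] k) (a : A) (z : BaseChange k K M) :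
    contract c ((a ⊗ₜ[k] (1 : K) : A ⊗[k] K) • z) = a • contract c z := by
  induction z using induction_on with
  | add y z hy hz => rw [smul_add, _root_.map_add, hy, hz, _root_.map_add, smul_add]
  | tmul m x =>
    rw [tmul_one_smul_mk, contract_mk, contract_mk, ← algebraMap_smul A (c x) (a • m),
      ← algebraMap_smul A (c x) m, smul_smul, smul_smul, Algebra.commutes]

theorem contract_map {N : Type*} [AddCommGroup N] [Module k N] [Module A N]
    [IsScalarTower k A N] (c : K →ₗ[k] k) (f : M →ₗ[A] N) (z : BaseChange k K M) :
    contract c (map k K f z) = f (contract c z) := by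
  induction z using induction_on with
  | add y z hy hz => simp only [_root_.map_add, hy, hz]
  | tmul m x =>
    rw [map_mk, contract_mk, contract_mk, ← algebraMap_smul A (c x) m, map_smul,
      algebraMap_smul]

variable {Y : Type*} [AddCommGroup Y] [Module (A ⊗[k] K) Y] (e : M ≃+ Y)
  (he : ∀ (a : A) m, e (a • m) = (a ⊗ₜ[k] (1 : K) : A ⊗[k] K) • e m)

-- The map `e` presents `M` as the restriction of `Y` to `A`. An additive equivalence is used
-- instead of equality of carriers so that `M` may live in another universe.
omit [Module k M] [IsScalarTower k A M] in
include he in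
theorem symm_tmul_one_smul (a : A) (y : Y) :
    e.symm ((a ⊗ₜ[k] (1 : K) : A ⊗[k] K) • y) = a • e.symm y := by
  rw [e.symm_apply_eq, he, e.apply_symm_apply]

/-- The `k`-linear map `x ↦ (1 ⊗ x) • y`. -/
def orbit (y : Y) : K →ₗ[k] M where
  toFun x := e.symm (((1 : A) ⊗ₜ[k] x : A ⊗[k] K) • y)
  map_add' x x' := by rw [TensorProduct.tmul_add, add_smul, _root_.map_add]
  map_smul' r x := by
    rw [RingHom.id_apply, ← algebraMap_smul A r (e.symm _), ← symm_tmul_one_smul e he, smul_smul,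
      Algebra.TensorProduct.tmul_mul_tmul, mul_one, one_mul, algebraMap_tmul_eq]

/-- The additive map `x ⊗ x' ↦ (1 ⊗ x) • y ⊗ x'`. -/
def tensorOrbit (y : Y) : K ⊗[k] K →+ BaseChange k K M :=
  (TensorProduct.map (orbit e he y) LinearMap.id).toAddMonoidHom

theorem tensorOrbit_tmul (y : Y) (x x' : K) :
    tensorOrbit e he y (x ⊗ₜ x') = mk k K (e.symm (((1 : A) ⊗ₜ[k] x : A ⊗[k] K) • y)) x' :=
  rfl

theorem tensorOrbit_add (y y' : Y) (t : K ⊗[k] K) :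
    tensorOrbit e he (y + y') t = tensorOrbit e he y t + tensorOrbit e he y' t := by
  induction t with
  | zero => simp
  | add s t hs ht => simp only [_root_.map_add, hs, ht]; abel
  | tmul x x' => simp only [tensorOrbit_tmul, smul_add, _root_.map_add, mk_add_left]

/-- A scalar `s` acting on `y` becomes multiplication of `t` by `s ⊗ 1`; by `smul_tensorOrbit`,
acting on the result it becomes multiplication by `1 ⊗ s`. Hence `y ↦ tensorOrbit e he y t` is
linear as soon as these two products agree for all `s`. -/
theorem tensorOrbit_tmul_smul (a : A) (s : K) (y : Y) (t : K ⊗[k] K) :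
    tensorOrbit e he ((a ⊗ₜ[k] s : A ⊗[k] K) • y) t =
      (a ⊗ₜ[k] (1 : K) : A ⊗[k] K) • tensorOrbit e he y (s ⊗ₜ[k] 1 * t) := by
  induction t with
  | zero => simp
  | add t t' hs ht => simp only [_root_.map_add, hs, ht, mul_add, smul_add]
  | tmul x x' =>
    rw [Algebra.TensorProduct.tmul_mul_tmul, tensorOrbit_tmul, tensorOrbit_tmul,
      tmul_one_smul_mk, ← symm_tmul_one_smul e he, smul_smul, smul_smul,
      Algebra.TensorProduct.tmul_mul_tmul, Algebra.TensorProduct.tmul_mul_tmul, one_mul, one_mul,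
      one_mul, mul_one, mul_comm s x]

theorem smul_tensorOrbit (a : A) (s : K) (y : Y) (t : K ⊗[k] K) :
    (a ⊗ₜ[k] s : A ⊗[k] K) • tensorOrbit e he y t =
      (a ⊗ₜ[k] (1 : K) : A ⊗[k] K) • tensorOrbit e he y (1 ⊗ₜ[k] s * t) := by
  induction t with
  | zero => simp
  | add t t' hs ht => simp only [_root_.map_add, hs, ht, mul_add, smul_add]
  | tmul x x' =>
    rw [Algebra.TensorProduct.tmul_mul_tmul, tensorOrbit_tmul, tensorOrbit_tmul,
      tmul_one_smul_mk, tmul_smul_mk, one_mul]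

/-- The counit `M ⊗ K → Y` for the restriction `M` of an `A ⊗ K`-module `Y`. -/
def counit : BaseChange k K M →ₗ[A ⊗[k] K] Y := lift e.toAddMonoidHom he

theorem counit_mk (m : M) (x : K) :
    counit e he (mk k K m x) = ((1 : A) ⊗ₜ[k] x : A ⊗[k] K) • e m := rfl

/-- The counit multiplies the two tensor factors together, so an element `t` with product `1` gives
a right inverse. -/
theorem counit_tensorOrbit (y : Y) (t : K ⊗[k] K) :
    counit e he (tensorOrbit e he y t) =
      ((1 : A) ⊗ₜ[k] (Algebra.TensorProduct.lmul' k t) : A ⊗[k] K) • y := by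
  induction t with
  | zero => simp
  | add t t' hs ht => simp only [_root_.map_add, hs, ht, TensorProduct.tmul_add, add_smul]
  | tmul x x' =>
    rw [tensorOrbit_tmul, counit_mk, e.apply_symm_apply, smul_smul,
      Algebra.TensorProduct.tmul_mul_tmul, one_mul, Algebra.TensorProduct.lmul'_apply_tmul,
      mul_comm]

theorem counit_comp_map {M' : Type*} [AddCommGroup M'] [Module k M'] [Module A M']
    [IsScalarTower k A M'] {Y' : Type*} [AddCommGroup Y'] [Module (A ⊗[k] K) Y'] (e' : M' ≃+ Y')
    (he' : ∀ (a : A) m, e' (a • m) = (a ⊗ₜ[k] (1 : K) : A ⊗[k] K) • e' m)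
    (g : M →ₗ[A] M') (f : Y →ₗ[A ⊗[k] K] Y') (hfg : ∀ m, e' (g m) = f (e m)) :
    counit e' he' ∘ₗ map k K g = f ∘ₗ counit e he := by
  refine hom_ext fun m => ?_
  rw [LinearMap.comp_apply, LinearMap.comp_apply, map_mk, counit_mk, counit_mk, map_smul, hfg]

variable [FiniteDimensional k K] [Algebra.IsSeparable k K]

/-- The section of the counit given by the separability idempotent. -/
def counitSection : Y →ₗ[A ⊗[k] K] BaseChange k K M :=
  haveI := Algebra.FormallyUnramified.of_isSeparable k K
  { toFun y := tensorOrbit e he y (Algebra.FormallyUnramified.elem k K)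
    map_add' y y' := tensorOrbit_add e he y y' _
    map_smul' b y := by
      rw [RingHom.id_apply]
      induction b with
      | zero =>
        rw [zero_smul, zero_smul]
        simpa using tensorOrbit_tmul_smul e he (0 : A) (0 : K) y
          (Algebra.FormallyUnramified.elem k K)
      | add b c hb hc => rw [add_smul, tensorOrbit_add, hb, hc, add_smul]
      | tmul a s =>
        rw [tensorOrbit_tmul_smul, smul_tensorOrbit e he a s,
          Algebra.FormallyUnramified.one_tmul_mul_elem] }

theorem counit_comp_counitSection : counit e he ∘ₗ counitSection e he = LinearMap.id := by
  have := Algebra.FormallyUnramified.of_isSeparable k K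
  ext y
  refine (counit_tensorOrbit e he y _).trans ?_
  rw [Algebra.FormallyUnramified.lmul_elem, ← Algebra.TensorProduct.one_def, one_smul,
    LinearMap.id_apply]

theorem map_counitSection {M' : Type*} [AddCommGroup M'] [Module k M'] [Module A M']
    [IsScalarTower k A M'] {Y' : Type*} [AddCommGroup Y'] [Module (A ⊗[k] K) Y'] (e' : M' ≃+ Y')
    (he' : ∀ (a : A) m, e' (a • m) = (a ⊗ₜ[k] (1 : K) : A ⊗[k] K) • e' m)
    (g : M →ₗ[A] M') (f : Y →ₗ[A ⊗[k] K] Y') (hfg : ∀ m, e' (g m) = f (e m)) (y : Y) :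
    map k K g (counitSection e he y) = counitSection e' he' (f y) := by
  have := Algebra.FormallyUnramified.of_isSeparable k K
  change map k K g (tensorOrbit e he y _) = tensorOrbit e' he' (f y) _
  -- Naturality holds for any fixed `t` in `K ⊗ K`, so it may be checked on pure tensors.
  generalize Algebra.FormallyUnramified.elem k K = t
  induction t with
  | zero => simp
  | add t t' hs ht => simp only [_root_.map_add, hs, ht]
  | tmul x x' =>
    rw [tensorOrbit_tmul, tensorOrbit_tmul, map_mk, ← map_smul f]
    congr 1
    rw [e'.eq_symm_apply, hfg, e.apply_symm_apply]

end Retracts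

end BaseChange

end BaseChange

/-! ### Finitely generated projectives: split idempotents and finite Homs -/

section FGProj

universe w

open scoped ModuleCat

instance (R : Type w) [Ring R] : IsIdempotentComplete (FGProj R) where
  idempotents_split X p hp := by
    obtain ⟨Y, i, e, hie, hei⟩ := IsIdempotentComplete.idempotents_split X.obj p.hom
      (congrArg InducedCategory.Hom.hom hp)
    obtain ⟨_, _⟩ := X.property
    have h : e.hom ∘ₗ i.hom = LinearMap.id := congrArg ModuleCat.Hom.hom hie
    have hY : isFGProjective R Y :=
      ⟨Module.Finite.of_surjective e.hom fun y => ⟨i.hom y, LinearMap.congr_fun h y⟩,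
        Module.Projective.of_split _ _ h⟩
    exact ⟨⟨Y, hY⟩, ObjectProperty.homMk i, ObjectProperty.homMk e,
      ObjectProperty.hom_ext _ hie, ObjectProperty.hom_ext _ hei⟩

theorem FGProj.finite_hom (k : Type*) [Field k] {R : Type w} [Ring R] [Algebra k R]
    [FiniteDimensional k R] (X Y : FGProj R) : Module.Finite k (X ⟶ Y) := by
  obtain ⟨_, _⟩ := X.property
  obtain ⟨_, _⟩ := Y.property
  have : Module.Finite k X.obj := Module.Finite.trans R X.obj
  have : Module.Finite k Y.obj := Module.Finite.trans R Y.obj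
  let φ : (X ⟶ Y) →ₗ[k] (X.obj →ₗ[k] Y.obj) :=
    { toFun f := f.hom.hom.restrictScalars k
      map_add' _ _ := rfl
      map_smul' _ _ := rfl }
  refine Module.Finite.of_injective φ fun f g hfg => ?_
  apply ObjectProperty.hom_ext
  ext x
  exact LinearMap.congr_fun hfg x

end FGProj

/-! ### Induction and restriction on finitely generated projectives -/

section Functors

universe u₁ u₂ u₃

variable (k : Type u₁) (K : Type u₂) (A : Type u₃) [Field k] [Field K] [Algebra k K]
  [Ring A] [Algebra k A]

section Induction

open scoped ModuleCat

/-- The functor `M ↦ M ⊗[k] K` from `A`-proj to `A ⊗[k] K`-proj. -/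
def FGProj.baseChange : FGProj A ⥤ FGProj (A ⊗[k] K) where
  obj M := ⟨ModuleCat.of (A ⊗[k] K) (BaseChange k K M.obj), by
    obtain ⟨_, _⟩ := M.property
    exact ⟨BaseChange.finite, BaseChange.projective⟩⟩
  map f := ObjectProperty.homMk (ModuleCat.ofHom (BaseChange.map k K f.hom.hom))
  map_id M := ObjectProperty.hom_ext _ (ModuleCat.hom_ext BaseChange.map_id)
  map_comp f g := ObjectProperty.hom_ext _
    (ModuleCat.hom_ext (BaseChange.map_comp f.hom.hom g.hom.hom))

instance : (FGProj.baseChange k K A).Additive where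
  map_add {_ _ f g} := ObjectProperty.hom_ext _
    (ModuleCat.hom_ext (BaseChange.map_add f.hom.hom g.hom.hom))

end Induction

section Restriction

variable {k K A} {Y : Type*} [AddCommGroup Y] [Module A Y] [Module (A ⊗[k] K) Y]
  [IsScalarTower A (A ⊗[k] K) Y]

theorem Module.Finite.of_tensorProduct [FiniteDimensional k K] [Module.Finite (A ⊗[k] K) Y] :
    Module.Finite A Y :=
  Module.Finite.trans (A ⊗[k] K) Y

/-- `A ⊗ K` is projective over `A`, being induced from a `k`-vector space; hence so are free `A ⊗
K`-modules and their summands. -/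
theorem Module.Projective.of_tensorProduct [Module.Projective (A ⊗[k] K) Y] :
    Module.Projective A Y := by
  obtain ⟨s, hs⟩ := Module.projective_def.1 (‹Module.Projective (A ⊗[k] K) Y›)
  exact Module.Projective.of_split (s.restrictScalars A)
    ((Finsupp.linearCombination (A ⊗[k] K) id).restrictScalars A) (LinearMap.ext hs)

variable (k K A)

/-- The `A`-module underlying an `A ⊗[k] K`-module. -/
abbrev leftModule (Y : Type*) [AddCommGroup Y] [Module (A ⊗[k] K) Y] : Module A Y :=
  Module.compHom Y (Algebra.TensorProduct.includeLeftRingHom : A →+* A ⊗[k] K)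

theorem leftModule_isScalarTower (Y : Type*) [AddCommGroup Y] [Module (A ⊗[k] K) Y] :
    letI := leftModule k K A Y
    IsScalarTower A (A ⊗[k] K) Y :=
  letI := leftModule k K A Y
  ⟨fun a b y => by
    change (a • b) • y = (a ⊗ₜ[k] (1 : K) : A ⊗[k] K) • b • y
    rw [smul_smul]
    congr 1
    induction b with
    | zero => simp
    | add b c hb hc => rw [smul_add, mul_add, hb, hc]
    | tmul a' x =>
      rw [Algebra.TensorProduct.tmul_mul_tmul, one_mul, TensorProduct.smul_tmul', smul_eq_mul]⟩

variable [FiniteDimensional k K]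

/-- `FGProj A` only contains modules in the universe of `A`, while `Q` lives in that of `A ⊗ K`.
Being finite over `A`, `Q` is a quotient of some `A ^ n` and can be shrunk. -/
instance (Q : FGProj (A ⊗[k] K)) : Small.{u₃} Q.obj := by
  obtain ⟨_, _⟩ := Q.property
  let _ := leftModule k K A Q.obj
  have := leftModule_isScalarTower k K A Q.obj
  have : Module.Finite A Q.obj := Module.Finite.of_tensorProduct (k := k) (K := K)
  exact Module.Finite.small A Q.obj

/-- The underlying module of the restriction along `A → A ⊗[k] K`, transported to the universe
of `A`. -/
def FGProj.Restriction (Q : FGProj (A ⊗[k] K)) : Type u₃ := Shrink.{u₃} Q.obj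

instance (Q : FGProj (A ⊗[k] K)) : AddCommGroup (FGProj.Restriction k K A Q) :=
  inferInstanceAs (AddCommGroup (Shrink.{u₃} Q.obj))

instance (Q : FGProj (A ⊗[k] K)) : Module A (FGProj.Restriction k K A Q) :=
  letI := leftModule k K A Q.obj
  inferInstanceAs (Module A (Shrink.{u₃} Q.obj))

/-- The restriction of an `A ⊗[k] K`-module to `A`. -/
def FGProj.restrictObj (Q : FGProj (A ⊗[k] K)) : FGProj A :=
  ⟨ModuleCat.of A (FGProj.Restriction k K A Q), by
    let _ := leftModule k K A Q.obj
    obtain ⟨_, _⟩ := Q.property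
    have := leftModule_isScalarTower k K A Q.obj
    have : Module.Finite A Q.obj := Module.Finite.of_tensorProduct (k := k) (K := K)
    have : Module.Projective A Q.obj := Module.Projective.of_tensorProduct (k := k) (K := K)
    let e : Q.obj ≃ₗ[A] FGProj.Restriction k K A Q := (Shrink.linearEquiv A Q.obj).symm
    exact ⟨Module.Finite.equiv e, Module.Projective.of_equiv e⟩⟩

/-- The identification of the restriction of an `A ⊗[k] K`-module with that module. -/
def FGProj.restrictEquiv (Q : FGProj (A ⊗[k] K)) : (FGProj.restrictObj k K A Q).obj ≃+ Q.obj :=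
  Shrink.addEquiv

theorem FGProj.restrictEquiv_smul (Q : FGProj (A ⊗[k] K)) (a : A)
    (m : (FGProj.restrictObj k K A Q).obj) :
    FGProj.restrictEquiv k K A Q (a • m) =
      (a ⊗ₜ[k] (1 : K) : A ⊗[k] K) • FGProj.restrictEquiv k K A Q m :=
  letI := leftModule k K A Q.obj
  (Shrink.linearEquiv A Q.obj).map_smul a m

/-- Restriction of a linear map along `A → A ⊗[k] K`. -/
def FGProj.restrictMap {Q Q' : FGProj (A ⊗[k] K)} (f : Q ⟶ Q') :
    (FGProj.restrictObj k K A Q).obj →ₗ[A] (FGProj.restrictObj k K A Q').obj where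
  toFun m := (FGProj.restrictEquiv k K A Q').symm (f.hom.hom (FGProj.restrictEquiv k K A Q m))
  map_add' m n := by simp only [map_add]
  map_smul' a m := by
    rw [AddEquiv.symm_apply_eq, FGProj.restrictEquiv_smul, FGProj.restrictEquiv_smul, map_smul,
      AddEquiv.apply_symm_apply, RingHom.id_apply]

theorem FGProj.restrictEquiv_restrictMap {Q Q' : FGProj (A ⊗[k] K)} (f : Q ⟶ Q')
    (m : (FGProj.restrictObj k K A Q).obj) :
    FGProj.restrictEquiv k K A Q' (FGProj.restrictMap k K A f m) =
      f.hom.hom (FGProj.restrictEquiv k K A Q m) :=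
  AddEquiv.apply_symm_apply _ _

theorem FGProj.restrictMap_add {Q Q' : FGProj (A ⊗[k] K)} (f g : Q ⟶ Q') :
    FGProj.restrictMap k K A (f + g) =
      FGProj.restrictMap k K A f + FGProj.restrictMap k K A g := by
  refine LinearMap.ext fun m => (FGProj.restrictEquiv k K A Q').injective ?_
  rw [LinearMap.add_apply, map_add, FGProj.restrictEquiv_restrictMap,
    FGProj.restrictEquiv_restrictMap, FGProj.restrictEquiv_restrictMap]
  rfl

/-- The restriction functor from `A ⊗[k] K`-proj to `A`-proj. -/
def FGProj.restrict : FGProj (A ⊗[k] K) ⥤ FGProj A where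
  obj := FGProj.restrictObj k K A
  map f := ObjectProperty.homMk (ModuleCat.ofHom (FGProj.restrictMap k K A f))
  map_id Q := by
    apply ObjectProperty.hom_ext
    ext m
    exact (FGProj.restrictEquiv k K A Q).injective (FGProj.restrictEquiv_restrictMap k K A _ m)
  map_comp {Q Q' Q''} f g := by
    apply ObjectProperty.hom_ext
    ext m
    apply (FGProj.restrictEquiv k K A Q'').injective
    refine (FGProj.restrictEquiv_restrictMap k K A _ m).trans ?_
    refine Eq.trans ?_ (FGProj.restrictEquiv_restrictMap k K A g _).symm
    exact congrArg g.hom.hom (FGProj.restrictEquiv_restrictMap k K A f m).symm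

instance : (FGProj.restrict k K A).Additive where
  map_add {_ _ f g} := ObjectProperty.hom_ext _
    (ModuleCat.hom_ext (FGProj.restrictMap_add k K A f g))

end Restriction

section Retracts

open scoped ModuleCat

variable [FiniteDimensional k K]

/-- The identification of the restriction of the base change of `M` with `M ⊗[k] K`. -/
def FGProj.restrictBaseChangeEquiv (M : FGProj A) :
    (FGProj.restrictObj k K A ((FGProj.baseChange k K A).obj M)).obj ≃+ BaseChange k K M.obj :=
  FGProj.restrictEquiv k K A ((FGProj.baseChange k K A).obj M)

theorem FGProj.restrictBaseChangeEquiv_smul (M : FGProj A) (a : A)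
    (m : (FGProj.restrictObj k K A ((FGProj.baseChange k K A).obj M)).obj) :
    FGProj.restrictBaseChangeEquiv k K A M (a • m) =
      (a ⊗ₜ[k] (1 : K) : A ⊗[k] K) • FGProj.restrictBaseChangeEquiv k K A M m :=
  FGProj.restrictEquiv_smul k K A ((FGProj.baseChange k K A).obj M) a m

theorem FGProj.restrictBaseChangeEquiv_naturality {M N : FGProj A} (f : M ⟶ N)
    (m : (FGProj.restrictObj k K A ((FGProj.baseChange k K A).obj M)).obj) :
    FGProj.restrictBaseChangeEquiv k K A N
        (FGProj.restrictMap k K A ((FGProj.baseChange k K A).map f) m) =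
      BaseChange.map k K f.hom.hom (FGProj.restrictBaseChangeEquiv k K A M m) :=
  FGProj.restrictEquiv_restrictMap k K A ((FGProj.baseChange k K A).map f) m

/-- The unit `m ↦ m ⊗ 1`. -/
def FGProj.unitMap (M : FGProj A) :
    M.obj →ₗ[A] (FGProj.restrictObj k K A ((FGProj.baseChange k K A).obj M)).obj where
  toFun m := (FGProj.restrictBaseChangeEquiv k K A M).symm (BaseChange.unit k K M.obj m)
  map_add' m n := by simp only [map_add]
  map_smul' a m := by
    rw [AddEquiv.symm_apply_eq, RingHom.id_apply, FGProj.restrictBaseChangeEquiv_smul,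
      AddEquiv.apply_symm_apply, BaseChange.unit_smul]

theorem FGProj.restrictBaseChangeEquiv_unitMap (M : FGProj A) (m : M.obj) :
    FGProj.restrictBaseChangeEquiv k K A M (FGProj.unitMap k K A M m) =
      BaseChange.mk k K m 1 :=
  AddEquiv.apply_symm_apply _ _

variable {k K} in
/-- The retraction `m ⊗ x ↦ c x • m`. -/
def FGProj.contractMap (c : K →ₗ[k] k) (M : FGProj A) :
    (FGProj.restrictObj k K A ((FGProj.baseChange k K A).obj M)).obj →ₗ[A] M.obj where
  toFun m := BaseChange.contract c (FGProj.restrictBaseChangeEquiv k K A M m)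
  map_add' m n := by simp only [map_add]
  map_smul' a m := by
    rw [FGProj.restrictBaseChangeEquiv_smul, BaseChange.contract_tmul_one_smul, RingHom.id_apply]

/-- Every `A`-module is naturally a retract of the restriction of its base change. -/
def FGProj.retractBaseChangeRestrict (c : K →ₗ[k] k) (hc : c 1 = 1) :
    Retract (𝟭 (FGProj A)) (FGProj.baseChange k K A ⋙ FGProj.restrict k K A) where
  i :=
    { app M := ObjectProperty.homMk (ModuleCat.ofHom (FGProj.unitMap k K A M))
      naturality M N f := by
        apply ObjectProperty.hom_ext
        apply ModuleCat.hom_ext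
        refine LinearMap.ext fun m => (FGProj.restrictBaseChangeEquiv k K A N).injective ?_
        refine (FGProj.restrictBaseChangeEquiv_unitMap k K A N (f.hom.hom m)).trans ?_
        refine Eq.trans ?_ (FGProj.restrictBaseChangeEquiv_naturality k K A f _).symm
        exact (BaseChange.map_mk f.hom.hom m 1).symm.trans (congrArg (BaseChange.map k K f.hom.hom)
          (FGProj.restrictBaseChangeEquiv_unitMap k K A M m).symm) }
  r :=
    { app M := ObjectProperty.homMk (ModuleCat.ofHom (FGProj.contractMap A c M))
      naturality M N f := by
        apply ObjectProperty.hom_ext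
        apply ModuleCat.hom_ext
        refine LinearMap.ext fun m => ?_
        refine (congrArg (BaseChange.contract c)
          (FGProj.restrictBaseChangeEquiv_naturality k K A f m)).trans ?_
        exact BaseChange.contract_map c f.hom.hom _ }
  retract := by
    refine NatTrans.ext (funext fun M => ?_)
    apply ObjectProperty.hom_ext
    apply ModuleCat.hom_ext
    refine LinearMap.ext fun m => ?_
    refine (congrArg (BaseChange.contract c)
      (FGProj.restrictBaseChangeEquiv_unitMap k K A M m)).trans ?_
    refine (BaseChange.contract_mk c m 1).trans ?_
    rw [hc, one_smul]
    rfl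

variable [Algebra.IsSeparable k K]

/-- Every `A ⊗[k] K`-module is naturally a retract of the base change of its restriction. -/
def FGProj.retractRestrictBaseChange :
    Retract (𝟭 (FGProj (A ⊗[k] K))) (FGProj.restrict k K A ⋙ FGProj.baseChange k K A) where
  i :=
    { app Q := ObjectProperty.homMk (ModuleCat.ofHom
        (BaseChange.counitSection (FGProj.restrictEquiv k K A Q)
          (FGProj.restrictEquiv_smul k K A Q)))
      naturality Q Q' f := by
        apply ObjectProperty.hom_ext
        ext y
        exact (BaseChange.map_counitSection (FGProj.restrictEquiv k K A Q)
          (FGProj.restrictEquiv_smul k K A Q) (FGProj.restrictEquiv k K A Q')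
          (FGProj.restrictEquiv_smul k K A Q') (FGProj.restrictMap k K A f) f.hom.hom
          (FGProj.restrictEquiv_restrictMap k K A f) y).symm }
  r :=
    { app Q := ObjectProperty.homMk (ModuleCat.ofHom
        (BaseChange.counit (FGProj.restrictEquiv k K A Q) (FGProj.restrictEquiv_smul k K A Q)))
      naturality Q Q' f := by
        apply ObjectProperty.hom_ext
        apply ModuleCat.hom_ext
        exact BaseChange.counit_comp_map (FGProj.restrictEquiv k K A Q)
          (FGProj.restrictEquiv_smul k K A Q) (FGProj.restrictEquiv k K A Q')
          (FGProj.restrictEquiv_smul k K A Q') (FGProj.restrictMap k K A f) f.hom.hom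
          (FGProj.restrictEquiv_restrictMap k K A f) }
  retract := by
    refine NatTrans.ext (funext fun Q => ?_)
    apply ObjectProperty.hom_ext
    apply ModuleCat.hom_ext
    exact BaseChange.counit_comp_counitSection (FGProj.restrictEquiv k K A Q)
      (FGProj.restrictEquiv_smul k K A Q)

end Retracts

end Functors

end

theorem lemma3p1 {k : Type*} {K : Type*} {A : Type*} [Field k] [Field K] [Algebra k K]
    [FiniteDimensional k K] [Algebra.IsSeparable k K]
    [Ring A] [Algebra k A] [FiniteDimensional k A] :
    strongGlobalDimension A = strongGlobalDimension (A ⊗[k] K) := by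
  -- A `k`-linear retraction of `k → K`, available because `k` is a field.
  obtain ⟨c, hc⟩ := (Algebra.linearMap k K).exists_leftInverse_of_injective
    (LinearMap.ker_eq_bot.2 (algebraMap k K).injective)
  have hc1 : c 1 = 1 := by simpa using LinearMap.congr_fun hc 1
  exact le_antisymm
    (iSup_length_le_iSup_length k (FGProj.finite_hom k) (FGProj.finite_hom k) _ _
      (FGProj.retractBaseChangeRestrict k K A c hc1))
    (iSup_length_le_iSup_length k (FGProj.finite_hom k) (FGProj.finite_hom k) _ _
      (FGProj.retractRestrictBaseChange k K A))
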